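/- **Setting.** Fix a function-free first-order signature with set $\mathbf P$ of predicate symbols and set $\Delta$ of constants (standard names; $\Delta$ is the Herbrand universe). An interpretation is a set of ground atoms; $\mathcal I$ is the set of all of them. MKNF formulae extend first-order formulae by the modalities $\mathbf K$ and $\mathbf{not}$. For an interpretation $I$ and $M,N\subseteq\mathcal I$, satisfaction in $(I,M,N)$ is as in $I$ for ground atoms, is usual for $\lnot,\land$, and $(I,M,N)\models\exists x\,\phi$ iff $(I,M,N)\models\phi[c/x]$ for some $c\in\Delta$; $(I,M,N)\models\mathbf K\phi$ iff $(J,M,N)\models\phi$ for all $J\in M$; $(I,M,N)\models\mathbf{not}\,\phi$ iff $(J,M,N)\not\models\phi$ for some $J\in N$. For a set $T$ of MKNF sentences, $M\models T$ means $(I,M,M)\models\phi$ for all $\phi\in T$, $I\in M$. An MKNF interpretation is a nonempty subset of $\mathcal I$. For a first-order theory $T$, $\mathsf{mod}(T)$ is the greatest $M\subseteq\mathcal I$ with $M\models T$. A literal is a ground atom $p$ or a default literal ${\sim}p$ (with ${\sim}{\sim}p=p$). A rule $r$ has a head literal $H(r)$ and a finite set $B(r)$ of body literals; it is positive if $H(r)$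 is an atom and a fact if $B(r)=\emptyset$. A program is a set of rules. An ontology is a set of axioms $\phi$ of a description logic, each with a translation $\kappa(\phi)$ into a first-order sentence. A hybrid knowledge base is a pair $\mathcal K=\langle\mathcal O,\mathcal P\rangle$ of an ontology and a program; $\mathsf{pr}(\cdot)$ denotes the set of predicate symbols occurring in an object, with $\mathsf{pr}(\phi)=\mathsf{pr}(\kappa(\phi))$ for an axiom $\phi$. Put $\pi(p)=\mathbf Kp$, $\pi({\sim}p)=\mathbf{not}\,p$, $\pi(r)=\bigl(\bigwedge_{L\in B(r)}\pi(L)\supset\pi(H(r))\bigr)$ and $\pi(\mathcal K)=\{\mathbf K\kappa(\phi)\mid\phi\in\mathcal O\}\cup\{\pi(r)\mid r\in\mathcal P\}$. A dynamic hybrid knowledge base is a finite sequence $\mathcal K=\langle\mathcal K_i\rangle_{i<n}$, $\mathcal K_i=\langle\mathcal O_i,\mathcal P_i\rangle$. *Basic case.* For interpretations $I,J,J'$ write $J\le_I J'$ if $I\mathbin\triangle J\subseteq I\mathbin\triangle J'$, and $J<_IJ'$ if $J\le_IJ'$ but not $J'\le_IJ$. For $M,N\subseteq\mathcal I$ let $M\oplus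 N=\bigcup_{I\in M}\{J\in N\mid\text{no }J'\in N\text{ has }J'<_IJ\}$. The minimal change update model of first-order theories $\langle T_i\rangle_{i<n}$ is $(\cdots(\mathsf{mod}(T_0)\oplus\mathsf{mod}(T_1))\oplus\cdots)\oplus\mathsf{mod}(T_{n-1})$, provided it is nonempty. An interpretation $I$ is a dynamic stable model of $\langle\mathcal P_i\rangle_{i<n}$ if $I\cup\{{\sim}p\mid p\notin I\}$ is the least model, with default literals read as fresh atoms, of the program consisting of (a) all rules $r$ having an occurrence $r\in\mathcal P_i$ that is not rejected, where the occurrence is rejected if for some $j\ge i$ there is $r'\in\mathcal P_j$ with $H(r)={\sim}H(r')$ and $I\models B(r')$; and (b) the facts ${\sim}p$ for all atoms $p$ such that no rule $r$ in any $\mathcal P_i$ has $H(r)=p$ and $I\models B(r)$. An MKNF interpretation $M$ is a dynamic MKNF model of a *basic* $\mathcal K$ if either all programs $\mathcal P_i$ consist of positive facts and $M$ is the minimal change update model of $\langle\kappa(\mathcal O_i)\cup\mathcal P_i\rangle_{i<n}$ (facts being read as ground atoms), or all $\mathcal O_i$ are empty and $M=\{J\in\mathcal I\mid I\subseteq J\}$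 for some dynamic stable model $I$ of $\langle\mathcal P_i\rangle_{i<n}$. *Splitting.* A set $U\subseteq\mathbf P$ is a splitting set for $\langle\mathcal O,\mathcal P\rangle$ if $\mathsf{pr}(\phi)\cap U\ne\emptyset$ implies $\mathsf{pr}(\phi)\subseteq U$ for $\phi\in\mathcal O$, and $\mathsf{pr}(H(r))\cap U\neq\emptyset$ implies $\mathsf{pr}(r)\subseteq U$ for $r\in\mathcal P$. The bottom $b_U$ keeps the axioms and rules whose predicate symbols all lie in $U$; the top $t_U$ keeps the others. The reduct $e_U(\langle\mathcal O,\mathcal P\rangle,X)$, for $X\subseteq\mathcal I$, has ontology $t_U(\mathcal O)$ and the rules $r'$ for which some $r\in t_U(\mathcal P)$ satisfies $X\models\{\pi(L)\mid L\in B(r),\mathsf{pr}(L)\subseteq U\}$, $H(r')=H(r)$ and $B(r')=\{L\in B(r)\mid\mathsf{pr}(L)\subseteq\mathbf P\setminus U\}$. For dynamic hybrid knowledge bases these operations are applied to each member. A splitting sequence for $\mathcal K=\langle\mathcal K_i\rangle_{i<n}$ is a sequence $U=\langle U_\alpha\rangle_{\alpha<\mu}$, with $\mu>0$ an ordinal,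 of splitting sets for every $\mathcal K_i$ that is monotone, continuous ($U_\alpha=\bigcup_{\eta<\alpha}U_\eta$ for limit $\alpha<\mu$) and has union $\mathbf P$. A dynamic hybrid knowledge base is reducible relative to $V\subseteq\mathbf P$ if either all rules $r$ of all its members are positive with $\mathsf{pr}(B(r))\subseteq V$, or the ontologies of all its members are empty. $U$ is update-enabling for $\mathcal K$ if $b_{U_0}(\mathcal K)$ is reducible relative to $\emptyset$ and $t_{U_\alpha}(b_{U_{\alpha+1}}(\mathcal K))$ is reducible relative to $U_\alpha$ whenever $\alpha+1<\mu$. $\mathcal K$ is updatable if it has an update-enabling splitting sequence. An MKNF interpretation $M$ is a dynamic MKNF model of an updatable $\mathcal K$ if, for some update-enabling splitting sequence $\langle U_\alpha\rangle_{\alpha<\mu}$ for $\mathcal K$, $M=\bigcap_{\alpha<\mu}X_\alpha$ where the $X_\alpha$ are MKNF interpretations such that $X_0$ is a dynamic MKNF model of the basic $b_{U_0}(\mathcal K)$; $X_{\alpha+1}$ is a dynamic MKNF model of the basic $e_{U_\alpha}\bigl(b_{U_{\alpha+1}}(\mathcal K),\bigcap_{\eta\le\alpha}X_\eta\bigr)$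 whenever $\alpha+1<\mu$; and $X_\alpha=\mathcal I$ for limit $\alpha<\mu$. **Theorem (Principle of Primacy of New Information).** Let $\mathcal K=\langle\mathcal K_i\rangle_{i<n}$ be an updatable dynamic hybrid knowledge base with $n>0$ and let $M$ be a dynamic MKNF model of $\mathcal K$. Then $M\models\pi(\mathcal K_{n-1})$. -/

import Mathlib

namespace HybridMKNF

universe u v w x

/-- A function-free first-order signature: predicate symbols with arities, and constants.
Under the standard names assumption the constants form the Herbrand universe. -/
structure Signature where
  Pred : Type u
  arity : Pred → ℕ
  Const : Type v

/-- Terms with (de Bruijn) variables among `Fin n`. -/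
inductive Term (S : Signature.{u, v}) (n : ℕ) : Type v
  | var : Fin n → Term S n
  | const : S.Const → Term S n

/-- MKNF formulas whose free variables are among `Fin n`; in `ex φ` the bound variable is the
variable `0` of `φ`. `verum` serves as the empty conjunction. -/
inductive Formula (S : Signature.{u, v}) : ℕ → Type (max u v)
  | verum {n : ℕ} : Formula S n
  | atom {n : ℕ} (P : S.Pred) (ts : Fin (S.arity P) → Term S n) : Formula S n
  | neg {n : ℕ} (φ : Formula S n) : Formula S n
  | and {n : ℕ} (φ ψ : Formula S n) : Formula S n
  | ex {n : ℕ} (φ : Formula S (n + 1)) : Formula S n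
  | know {n : ℕ} (φ : Formula S n) : Formula S n
  | naf {n : ℕ} (φ : Formula S n) : Formula S n

abbrev Sentence (S : Signature.{u, v}) := Formula S 0

namespace Formula

variable {S : Signature.{u, v}}

/-- The predicate symbols relevant to a formula. -/
def preds : {n : ℕ} → Formula S n → Set S.Pred
  | _, verum => ∅
  | _, atom P _ => {P}
  | _, neg φ => φ.preds
  | _, and φ ψ => φ.preds ∪ ψ.preds
  | _, ex φ => φ.preds
  | _, know φ => φ.preds
  | _, naf φ => φ.preds

/-- A formula is first-order if it contains no modal operator. -/
def IsFirstOrder : {n : ℕ} → Formula S n → Prop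
  | _, verum => True
  | _, atom _ _ => True
  | _, neg φ => φ.IsFirstOrder
  | _, and φ ψ => φ.IsFirstOrder ∧ ψ.IsFirstOrder
  | _, ex φ => φ.IsFirstOrder
  | _, know _ => False
  | _, naf _ => False

/-- `imp φ ψ` is `ψ ⊂ φ`. -/
def imp {n : ℕ} (φ ψ : Formula S n) : Formula S n := neg (and φ (neg ψ))

def conj {n : ℕ} (l : List (Formula S n)) : Formula S n := l.foldr and verum

end Formula

structure GroundAtom (S : Signature.{u, v}) where
  pred : S.Pred
  args : Fin (S.arity pred) → S.Const

/-- Herbrand interpretations, as sets of ground atoms. -/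
abbrev Interp (S : Signature.{u, v}) := Set (GroundAtom S)

def GroundAtom.toSentence {S : Signature.{u, v}} (p : GroundAtom S) : Sentence S :=
  Formula.atom p.pred fun i => Term.const (p.args i)

def Term.eval {S : Signature.{u, v}} {n : ℕ} (e : Fin n → S.Const) : Term S n → S.Const
  | var i => e i
  | const c => c

/-- `Sat M N φ I e`: the MKNF structure `(I, M, N)` satisfies the sentence obtained from `φ` by
replacing each free variable `i` by the constant `e i`. -/
def Sat {S : Signature.{u, v}} (M N : Set (Interp S)) :
    {n : ℕ} → Formula S n → Interp S → (Fin n → S.Const) → Prop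
  | _, .verum, _, _ => True
  | _, .atom P ts, I, e => (⟨P, fun i => (ts i).eval e⟩ : GroundAtom S) ∈ I
  | _, .neg φ, I, e => ¬ Sat M N φ I e
  | _, .and φ ψ, I, e => Sat M N φ I e ∧ Sat M N ψ I e
  | _, .ex φ, I, e => ∃ c : S.Const, Sat M N φ I (Matrix.vecCons c e)
  | _, .know φ, _, e => ∀ J ∈ M, Sat M N φ J e
  | _, .naf φ, _, e => ∃ J ∈ N, ¬ Sat M N φ J e

/-- `M ⊨ T` for a set `T` of MKNF sentences. -/
def Models {S : Signature.{u, v}} (M : Set (Interp S)) (T : Set (Sentence S)) : Prop :=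
  ∀ φ ∈ T, ∀ I ∈ M, Sat M M φ I ![]

/-- The union of all `M` with `M ⊨ T`; this is the greatest such `M` whenever a greatest one
exists. -/
def modelSet {S : Signature.{u, v}} (T : Set (Sentence S)) : Set (Interp S) :=
  ⋃₀ {M | Models M T}

theorem Sat.congr_firstOrder {S : Signature.{u, v}} {M N M' N' : Set (Interp S)} :
    ∀ {n : ℕ} (φ : Formula S n), φ.IsFirstOrder → ∀ (I : Interp S) (e : Fin n → S.Const),
      (Sat M N φ I e ↔ Sat M' N' φ I e)
  | _, .verum, _, _, _ => Iff.rfl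
  | _, .atom _ _, _, _, _ => Iff.rfl
  | _, .neg φ, h, I, e => not_congr (Sat.congr_firstOrder φ h I e)
  | _, .and φ ψ, h, I, e =>
      and_congr (Sat.congr_firstOrder φ h.1 I e) (Sat.congr_firstOrder ψ h.2 I e)
  | _, .ex φ, h, I, e => exists_congr fun c => Sat.congr_firstOrder φ h I (Matrix.vecCons c e)
  | _, .know _, h, _, _ => h.elim
  | _, .naf _, h, _, _ => h.elim

/-- For a first-order theory the greatest `M` with `M ⊨ T` exists, and it is `modelSet T`. -/
theorem isGreatest_modelSet {S : Signature.{u, v}} (T : Set (Sentence S))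
    (hT : ∀ φ ∈ T, φ.IsFirstOrder) : IsGreatest {M | Models M T} (modelSet T) := by
  refine ⟨?_, fun M hM => Set.subset_sUnion_of_mem hM⟩
  rintro φ hφ I ⟨M, hM, hI⟩
  exact (Sat.congr_firstOrder φ (hT φ hφ) I _).1 (hM φ hφ I hI)

/-- A description logic, given by its axioms and their translation into first-order
sentences. -/
structure DescriptionLogic (S : Signature.{u, v}) where
  Axiom : Type w
  toFO : Axiom → {φ : Sentence S // φ.IsFirstOrder}

def DescriptionLogic.preds {S : Signature.{u, v}} (D : DescriptionLogic.{u, v, w} S)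
    (a : D.Axiom) : Set S.Pred := (D.toFO a).1.preds

/-- Literals: ground atoms `p` and default literals `∼p`. -/
inductive Literal (S : Signature.{u, v}) : Type (max u v)
  | pos : GroundAtom S → Literal S
  | neg : GroundAtom S → Literal S

namespace Literal

variable {S : Signature.{u, v}}

/-- Default negation of a literal; double default negation is absorbed. -/
def compl : Literal S → Literal S
  | pos p => neg p
  | neg p => pos p

def preds : Literal S → Set S.Pred
  | pos p => {p.pred}
  | neg p => {p.pred}

def HoldsIn (I : Interp S) : Literal S → Prop
  | pos p => p ∈ I
  | neg p => p ∉ I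

/-- The translation `π` of literals. -/
def toMKNF : Literal S → Sentence S
  | pos p => .know p.toSentence
  | neg p => .naf p.toSentence

end Literal

structure Rule (S : Signature.{u, v}) where
  head : Literal S
  body : Finset (Literal S)

namespace Rule

variable {S : Signature.{u, v}}

def bodyPreds (r : Rule S) : Set S.Pred := ⋃ L ∈ r.body, L.preds

def preds (r : Rule S) : Set S.Pred := r.head.preds ∪ r.bodyPreds

def IsPositive (r : Rule S) : Prop := ∃ p, r.head = .pos p

def IsFact (r : Rule S) : Prop := r.body = ∅

def BodyHolds (I : Interp S) (r : Rule S) : Prop := ∀ L ∈ r.body, L.HoldsIn I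

/-- The translation `π` of rules: `π(H(r)) ⊂ ⋀ π(B(r))`. -/
noncomputable def toMKNF (r : Rule S) : Sentence S :=
  Formula.imp (Formula.conj (r.body.toList.map Literal.toMKNF)) r.head.toMKNF

/-- The rules are conflicting: the head of one is the default negation of the head of the
other. -/
def Conflicts (r r' : Rule S) : Prop := r.head = r'.head.compl

end Rule

/-- Generalised logic programs. -/
abbrev Program (S : Signature.{u, v}) := Set (Rule S)

/-! ### Minimal change updates -/

section MinimalChange

variable {S : Signature.{u, v}}

def restrictPred (P : S.Pred) (I : Interp S) : Interp S := {p ∈ I | p.pred = P}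

/-- The difference in the interpretation of `P` between `I` and `J`. -/
def diff (P : S.Pred) (I J : Interp S) : Set (GroundAtom S) :=
  (restrictPred P I \ restrictPred P J) ∪ (restrictPred P J \ restrictPred P I)

/-- `J` is at least as close to `I` as `J'`. -/
def AtLeastAsClose (I J J' : Interp S) : Prop := ∀ P, diff P I J ⊆ diff P I J'

/-- `J` is closer to `I` than `J'`. -/
def Closer (I J J' : Interp S) : Prop := AtLeastAsClose I J J' ∧ ¬ AtLeastAsClose I J' J

/-- `M ⊕ N`. -/
def update (M N : Set (Interp S)) : Set (Interp S) :=
  ⋃ I ∈ M, {J ∈ N | ¬ ∃ J' ∈ N, Closer I J' J}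

/-- `(⋯((N₀ ⊕ N₁) ⊕ N₂) ⊕ ⋯) ⊕ Nₙ₋₁`; for the empty sequence, all interpretations. -/
def updateSeq : (n : ℕ) → (Fin n → Set (Interp S)) → Set (Interp S)
  | 0, _ => Set.univ
  | 1, N => N 0
  | n + 2, N => update (updateSeq (n + 1) fun i => N i.castSucc) (N (Fin.last (n + 1)))

/-- `M` is the minimal change update model of the sequence of first-order theories `T`. -/
def IsMinimalChangeUpdateModel {n : ℕ} (T : Fin n → Set (Sentence S)) (M : Set (Interp S)) :
    Prop :=
  M.Nonempty ∧ M = updateSeq n fun i => modelSet (T i)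

end MinimalChange

/-! ### Rule updates -/

section RuleUpdates

variable {S : Signature.{u, v}}

/-- The least model of a program in which each default literal `∼p` is read as a fresh atom;
so models are sets of literals. -/
def least (Q : Program S) : Set (Literal S) :=
  ⋂₀ {A | ∀ r ∈ Q, (∀ L ∈ r.body, L ∈ A) → r.head ∈ A}

/-- `I' = I ∪ {∼p | p ∉ I}`. -/
def extend (I : Interp S) : Set (Literal S) := {L | L.HoldsIn I}

/-- The multiset of all rules in members of a dynamic logic program, as the set of rule
occurrences: `(i, r)` is the occurrence of `r` in the `i`-th program. -/
def occurrences {n : ℕ} (Q : Fin n → Program S) : Set (Fin n × Rule S) := {o | o.2 ∈ Q o.1}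

/-- The rejected rule occurrences. -/
def rejected {n : ℕ} (Q : Fin n → Program S) (I : Interp S) : Set (Fin n × Rule S) :=
  {o | o.2 ∈ Q o.1 ∧ ∃ j, ∃ r' ∈ Q j, o.1 ≤ j ∧ o.2.Conflicts r' ∧ r'.BodyHolds I}

/-- The default assumptions, as facts `∼p`. -/
def defaults {n : ℕ} (Q : Fin n → Program S) (I : Interp S) : Program S :=
  {d | ∃ p, d = ⟨.neg p, ∅⟩ ∧ ¬ ∃ i, ∃ r ∈ Q i, r.head = .pos p ∧ r.BodyHolds I}

def IsDynamicStableModel {n : ℕ} (Q : Fin n → Program S) (I : Interp S) : Prop :=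
  extend I = least (Prod.snd '' (occurrences Q \ rejected Q I) ∪ defaults Q I)

end RuleUpdates

/-! ### Hybrid knowledge bases and splitting -/

structure HybridKB {S : Signature.{u, v}} (D : DescriptionLogic.{u, v, w} S) where
  ont : Set D.Axiom
  prog : Program S

/-- Dynamic hybrid knowledge bases `⟨K_i⟩_{i < n}`. -/
abbrev DynamicKB {S : Signature.{u, v}} (D : DescriptionLogic.{u, v, w} S) (n : ℕ) :=
  Fin n → HybridKB D

namespace HybridKB

variable {S : Signature.{u, v}} {D : DescriptionLogic.{u, v, w} S}

/-- The translation `π` of hybrid knowledge bases. -/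
def toMKNF (K : HybridKB D) : Set (Sentence S) :=
  {φ | ∃ a ∈ K.ont, φ = .know (D.toFO a).1} ∪ {φ | ∃ r ∈ K.prog, φ = r.toMKNF}

def IsSplittingSet (U : Set S.Pred) (K : HybridKB D) : Prop :=
  (∀ a ∈ K.ont, (D.preds a ∩ U).Nonempty → D.preds a ⊆ U) ∧
  (∀ r ∈ K.prog, (r.head.preds ∩ U).Nonempty → r.preds ⊆ U)

def bottom (U : Set S.Pred) (K : HybridKB D) : HybridKB D where
  ont := {a ∈ K.ont | D.preds a ⊆ U}
  prog := {r ∈ K.prog | r.preds ⊆ U}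

def top (U : Set S.Pred) (K : HybridKB D) : HybridKB D where
  ont := K.ont \ (bottom U K).ont
  prog := K.prog \ (bottom U K).prog

/-- The splitting set reduct `e_U(K, X)`. -/
def reduct (U : Set S.Pred) (K : HybridKB D) (X : Set (Interp S)) : HybridKB D where
  ont := (top U K).ont
  prog := {r' | ∃ r ∈ (top U K).prog,
    Models X {φ | ∃ L ∈ r.body, L.preds ⊆ U ∧ φ = L.toMKNF} ∧
    r'.head = r.head ∧ ∀ L, L ∈ r'.body ↔ L ∈ r.body ∧ L.preds ⊆ Uᶜ}

def IsOBased (K : HybridKB D) : Prop := ∀ r ∈ K.prog, r.IsPositive ∧ r.IsFact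

def IsPBased (K : HybridKB D) : Prop := K.ont = ∅

def IsOReducible (U : Set S.Pred) (K : HybridKB D) : Prop :=
  ∀ r ∈ K.prog, r.IsPositive ∧ r.bodyPreds ⊆ U

def IsPReducible (_U : Set S.Pred) (K : HybridKB D) : Prop := K.ont = ∅

/-- The first-order theory consisting of the translated ontology axioms together with the
positive facts of the program, read as ground atoms. -/
def foTheory (K : HybridKB D) : Set (Sentence S) :=
  {φ | ∃ a ∈ K.ont, φ = (D.toFO a).1} ∪
  {φ | ∃ r ∈ K.prog, ∃ p, r.head = .pos p ∧ r.IsFact ∧ φ = p.toSentence}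

/-- `⟨U_α⟩_{α < μ}` is a splitting sequence; only the values `U α` with `α < μ` matter. -/
structure IsSplittingSequence (μ : Ordinal.{x}) (U : Ordinal.{x} → Set S.Pred)
    (K : HybridKB D) : Prop where
  pos : 0 < μ
  splitting : ∀ α < μ, IsSplittingSet (U α) K
  mono : ∀ α β, α ≤ β → β < μ → U α ⊆ U β
  continuous : ∀ α < μ, Order.IsSuccLimit α → U α = ⋃ η < α, U η
  exhausts : (⋃ α < μ, U α) = Set.univ

end HybridKB

namespace DynamicKB

variable {S : Signature.{u, v}} {D : DescriptionLogic.{u, v, w} S} {n : ℕ}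

def bottom (U : Set S.Pred) (K : DynamicKB D n) : DynamicKB D n := fun i => (K i).bottom U

def top (U : Set S.Pred) (K : DynamicKB D n) : DynamicKB D n := fun i => (K i).top U

def reduct (U : Set S.Pred) (K : DynamicKB D n) (X : Set (Interp S)) : DynamicKB D n :=
  fun i => (K i).reduct U X

def IsSplittingSequence (μ : Ordinal.{x}) (U : Ordinal.{x} → Set S.Pred)
    (K : DynamicKB D n) : Prop := ∀ i, (K i).IsSplittingSequence μ U

def IsOBased (K : DynamicKB D n) : Prop := ∀ i, (K i).IsOBased

def IsPBased (K : DynamicKB D n) : Prop := ∀ i, (K i).IsPBased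

/-- Reducible relative to `U`: either every member is `O`-reducible, or every member is
`P`-reducible. -/
def IsReducible (U : Set S.Pred) (K : DynamicKB D n) : Prop :=
  (∀ i, (K i).IsOReducible U) ∨ (∀ i, (K i).IsPReducible U)

/-- Dynamic MKNF models of a basic dynamic hybrid knowledge base. -/
def IsBasicDynamicModel (K : DynamicKB D n) (M : Set (Interp S)) : Prop :=
  M.Nonempty ∧
  ((IsOBased K ∧ IsMinimalChangeUpdateModel (fun i => (K i).foTheory) M) ∨
   (IsPBased K ∧ ∃ I, IsDynamicStableModel (fun i => (K i).prog) I ∧ M = {J | I ⊆ J}))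

structure IsUpdateEnabling (μ : Ordinal.{x}) (U : Ordinal.{x} → Set S.Pred)
    (K : DynamicKB D n) : Prop where
  splitting : IsSplittingSequence μ U K
  zero : IsReducible ∅ (bottom (U 0) K)
  succ : ∀ α, α + 1 < μ → IsReducible (U α) (top (U α) (bottom (U (α + 1)) K))

def IsUpdatable (K : DynamicKB D n) : Prop :=
  ∃ (μ : Ordinal.{x}) (U : Ordinal.{x} → Set S.Pred), IsUpdateEnabling μ U K

/-- `⟨X_α⟩_{α < μ}` is a solution to `K` with respect to `⟨U_α⟩_{α < μ}`. -/
structure IsSolution (μ : Ordinal.{x}) (U : Ordinal.{x} → Set S.Pred) (K : DynamicKB D n)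
    (X : Ordinal.{x} → Set (Interp S)) : Prop where
  nonempty : ∀ α < μ, (X α).Nonempty
  zero : IsBasicDynamicModel (bottom (U 0) K) (X 0)
  succ : ∀ α, α + 1 < μ →
    IsBasicDynamicModel (reduct (U α) (bottom (U (α + 1)) K) (⋂ η ≤ α, X η)) (X (α + 1))
  limit : ∀ α < μ, Order.IsSuccLimit α → X α = Set.univ

def IsDynamicModelWrt (μ : Ordinal.{x}) (U : Ordinal.{x} → Set S.Pred) (K : DynamicKB D n)
    (M : Set (Interp S)) : Prop :=
  M.Nonempty ∧ ∃ X, IsSolution μ U K X ∧ M = ⋂ α < μ, X α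

/-- Dynamic MKNF models of an updatable dynamic hybrid knowledge base. -/
def IsDynamicModel (K : DynamicKB D n) (M : Set (Interp S)) : Prop :=
  ∃ (μ : Ordinal.{x}) (U : Ordinal.{x} → Set S.Pred),
    IsUpdateEnabling μ U K ∧ IsDynamicModelWrt μ U K M

end DynamicKB

end HybridMKNF

namespace HybridMKNF

universe u v w x

variable {S : Signature.{u, v}}

/-! A splitting sequence cuts the predicate symbols into disjoint layers, nonempty only at stage
zero and at successor stages. The basic knowledge base solved at stage `α` has all its axioms and
rule heads over layer `α`, so `X α` constrains that layer only (`IsSolution.dependsOn`). The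
intersection `M` of the stages therefore behaves like a product: any member of `X α`, restricted to
its layer, can be glued onto a fixed member of `M` without leaving `M`. Hence a literal over layer
`α` has the same status in `M`, in `X α` and in anything between (`IsSolution.knownIn_iff`).

This reduces the claim to a single stage: each axiom or rule of the last member survives, the rule
possibly with a shortened body, into the basic knowledge base of one stage. There, primacy has two
sources. A minimal change update selects its results among the models of the last theory
(`updateSeq_subset_last`). In a dynamic stable model, a last-program rule with true body rejects
every rule with the complementary head and blocks the complementary default
(`compl_head_notMem_least`). -/

/-! ### Sets of interpretations that depend on a set of predicate symbols only -/

/-- `I` and `J` interpret the predicate symbols in `V` in the same way. -/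
def AgreeOn (V : Set S.Pred) (I J : Interp S) : Prop := ∀ p, p.pred ∈ V → (p ∈ I ↔ p ∈ J)

/-- Membership in `X` is determined by the interpretation of the predicate symbols in `V`. -/
def DependsOn (V : Set S.Pred) (X : Set (Interp S)) : Prop :=
  ∀ ⦃J J'⦄, AgreeOn V J J' → J ∈ X → J' ∈ X

/-- The interpretation that coincides with `I` on `V` and with `J` outside of `V`. -/
def merge (V : Set S.Pred) (I J : Interp S) : Interp S :=
  {p | (p.pred ∈ V ∧ p ∈ I) ∨ (p.pred ∉ V ∧ p ∈ J)}

theorem mem_merge_of_mem {V : Set S.Pred} {I J : Interp S} {p : GroundAtom S}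
    (h : p.pred ∈ V) : p ∈ merge V I J ↔ p ∈ I := by simp [merge, h]

theorem mem_merge_of_notMem {V : Set S.Pred} {I J : Interp S} {p : GroundAtom S}
    (h : p.pred ∉ V) : p ∈ merge V I J ↔ p ∈ J := by simp [merge, h]

theorem agreeOn_merge (V : Set S.Pred) (I J : Interp S) : AgreeOn V I (merge V I J) :=
  fun _ h => (mem_merge_of_mem h).symm

theorem agreeOn_merge_of_disjoint {V W : Set S.Pred} (h : Disjoint V W) (I J : Interp S) :
    AgreeOn W J (merge V I J) :=
  fun _ hp => (mem_merge_of_notMem (h.notMem_of_mem_right hp)).symm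

theorem Sat.congr_agreeOn {M N : Set (Interp S)} {V : Set S.Pred} {I J : Interp S}
    (h : AgreeOn V I J) : ∀ {n : ℕ} (φ : Formula S n), φ.IsFirstOrder → φ.preds ⊆ V →
      ∀ e : Fin n → S.Const, (Sat M N φ I e ↔ Sat M N φ J e)
  | _, .verum, _, _, _ => Iff.rfl
  | _, .atom _ _, _, hV, _ => h _ (hV rfl)
  | _, .neg φ, hφ, hV, e => not_congr (Sat.congr_agreeOn h φ hφ hV e)
  | _, .and φ ψ, hφ, hV, e =>
      and_congr (Sat.congr_agreeOn h φ hφ.1 (Set.subset_union_left.trans hV) e)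
        (Sat.congr_agreeOn h ψ hφ.2 (Set.subset_union_right.trans hV) e)
  | _, .ex φ, hφ, hV, e =>
      exists_congr fun c => Sat.congr_agreeOn h φ hφ hV (Matrix.vecCons c e)
  | _, .know _, hφ, _, _ => hφ.elim
  | _, .naf _, hφ, _, _ => hφ.elim

theorem mem_modelSet_iff {T : Set (Sentence S)} (hT : ∀ φ ∈ T, φ.IsFirstOrder)
    (M N : Set (Interp S)) {I : Interp S} :
    I ∈ modelSet T ↔ ∀ φ ∈ T, Sat M N φ I ![] := by
  constructor
  · intro hI φ hφ
    exact (Sat.congr_firstOrder φ (hT φ hφ) I _).1 ((isGreatest_modelSet T hT).1 φ hφ I hI)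
  · intro h
    refine ⟨{I}, ?_, rfl⟩
    rintro φ hφ _ rfl
    exact (Sat.congr_firstOrder φ (hT φ hφ) _ _).1 (h φ hφ)

theorem dependsOn_modelSet {V : Set S.Pred} {T : Set (Sentence S)}
    (hT : ∀ φ ∈ T, φ.IsFirstOrder) (hV : ∀ φ ∈ T, φ.preds ⊆ V) : DependsOn V (modelSet T) := by
  intro J J' h hJ
  rw [mem_modelSet_iff hT ∅ ∅] at hJ ⊢
  exact fun φ hφ => (Sat.congr_agreeOn h φ (hT φ hφ) (hV φ hφ) _).1 (hJ φ hφ)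

/-! ### Minimal change updates -/

/-- Each atom has one predicate symbol, so the inclusions for all symbols amount to one inclusion of
symmetric differences, stated here in contrapositive form. -/
theorem atLeastAsClose_iff {I J J' : Interp S} :
    AtLeastAsClose I J J' ↔ ∀ p, (p ∈ I ↔ p ∈ J') → (p ∈ I ↔ p ∈ J) := by
  simp only [AtLeastAsClose, diff, restrictPred, Set.subset_def, Set.mem_union, Set.mem_sdiff,
    Set.mem_ofPred_eq]
  constructor
  · intro h p hp
    have := h p.pred p
    tauto
  · intro h P p hp
    have := h p
    tauto

theorem DependsOn.update {V : Set S.Pred} {M N : Set (Interp S)} (hM : DependsOn V M)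
    (hN : DependsOn V N) : DependsOn V (update M N) := by
  intro J J' h hJ
  simp only [HybridMKNF.update, Set.mem_iUnion, Set.mem_ofPred_eq, exists_prop] at hJ ⊢
  obtain ⟨I, hI, hJN, hmin⟩ := hJ
  -- The origin is changed to match `J'` outside `V`, so the distance to `J'` is concentrated on
  -- `V`, where it equals that between `I` and `J`.
  refine ⟨merge V I J', hM (agreeOn_merge V I J') hI, hN h hJN, ?_⟩
  rintro ⟨L, hL, hle, hnle⟩
  -- A competitor `L` of `J'` yields a competitor of `J` by keeping only its part on `V`; strictness
  -- survives because outside `V` the new origin already coincides with `J'`.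
  refine hmin ⟨merge V L J, hN (agreeOn_merge V L J) hL, ?_, fun hle' => hnle ?_⟩
  · rw [atLeastAsClose_iff] at hle ⊢
    intro p hp
    by_cases hpV : p.pred ∈ V
    · have := hle p
      rw [mem_merge_of_mem hpV, ← h p hpV] at this
      rw [mem_merge_of_mem hpV]
      exact this hp
    · rwa [mem_merge_of_notMem hpV]
  · rw [atLeastAsClose_iff] at hle' ⊢
    intro p hp
    by_cases hpV : p.pred ∈ V
    · have := hle' p
      rw [mem_merge_of_mem hpV] at this hp
      rw [mem_merge_of_mem hpV, ← h p hpV]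
      exact this hp
    · exact mem_merge_of_notMem hpV

theorem dependsOn_updateSeq {V : Set S.Pred} : ∀ (n : ℕ) (N : Fin n → Set (Interp S)),
    (∀ i, DependsOn V (N i)) → DependsOn V (updateSeq n N)
  | 0, _, _ => fun _ _ _ _ => trivial
  | 1, _, h => h 0
  | n + 2, _, h => (dependsOn_updateSeq (n + 1) _ fun i => h i.castSucc).update (h _)

theorem updateSeq_subset_last : ∀ (n : ℕ) (N : Fin (n + 1) → Set (Interp S)),
    updateSeq (n + 1) N ⊆ N (Fin.last n)
  | 0, _ => subset_rfl
  | _ + 1, _ => Set.iUnion₂_subset fun _ _ => Set.sep_subset _ _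

/-! ### Dynamic stable models -/

/-- The set of all heads is closed under the rules, hence contains the least model. -/
theorem exists_head_of_mem_least {Q : Program S} {L : Literal S} (hL : L ∈ least Q) :
    ∃ r ∈ Q, r.head = L := by
  exact hL {L | ∃ r ∈ Q, r.head = L} fun r hr _ => ⟨r, hr, rfl⟩

theorem Literal.compl_compl (L : Literal S) : L.compl.compl = L := by cases L <;> rfl

theorem Literal.holdsIn_or_compl (I : Interp S) (L : Literal S) :
    L.HoldsIn I ∨ L.compl.HoldsIn I := by
  cases L with
  | pos p => exact em _
  | neg p => exact (em _).symm

theorem IsDynamicStableModel.exists_rule_of_mem {n : ℕ} {Q : Fin n → Program S} {I : Interp S}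
    (h : IsDynamicStableModel Q I) {p : GroundAtom S} (hp : p ∈ I) :
    ∃ i, ∃ r ∈ Q i, r.head = .pos p := by
  have hmem : Literal.pos p ∈ extend I := hp
  rw [h] at hmem
  obtain ⟨r, ⟨o, ⟨ho, -⟩, rfl⟩ | ⟨q, rfl, -⟩, hr⟩ := exists_head_of_mem_least hmem
  · exact ⟨o.1, o.2, ho, hr⟩
  · cases hr

/-- If a rule in the last program has a satisfied body, then the complement of its head is not
derivable. -/
theorem compl_head_notMem_least {n : ℕ} {Q : Fin (n + 1) → Program S} {I : Interp S}
    {r : Rule S} (hr : r ∈ Q (Fin.last n)) (hB : r.BodyHolds I) :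
    r.head.compl ∉ least (Prod.snd '' (occurrences Q \ rejected Q I) ∪ defaults Q I) := by
  intro hmem
  obtain ⟨s, ⟨o, ⟨ho, hrej⟩, rfl⟩ | ⟨q, rfl, hq⟩, hs⟩ := exists_head_of_mem_least hmem
  -- Nothing comes after the last program, so `r` can reject an occurrence from any index.
  · exact hrej ⟨ho, Fin.last n, r, hr, Fin.le_last _, hs, hB⟩
  · refine hq ⟨Fin.last n, r, hr, ?_, hB⟩
    rw [← r.head.compl_compl, ← hs]
    rfl

theorem IsDynamicStableModel.head_holds {n : ℕ} {Q : Fin (n + 1) → Program S} {I : Interp S}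
    (h : IsDynamicStableModel Q I) {r : Rule S} (hr : r ∈ Q (Fin.last n))
    (hB : r.BodyHolds I) : r.head.HoldsIn I := by
  refine (r.head.holdsIn_or_compl I).resolve_right fun hh => ?_
  have hmem : r.head.compl ∈ extend I := hh
  rw [h] at hmem
  exact compl_head_notMem_least hr hB hmem

/-! ### Satisfaction of literals and rules -/

/-- `X ⊨ π(L)`, for nonempty `X`. -/
def Literal.KnownIn (X : Set (Interp S)) : Literal S → Prop
  | .pos p => ∀ J ∈ X, p ∈ J
  | .neg p => ∃ J ∈ X, p ∉ J

theorem sat_literal_toMKNF {X : Set (Interp S)} {L : Literal S} {I : Interp S}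
    {e : Fin 0 → S.Const} : Sat X X L.toMKNF I e ↔ L.KnownIn X := by
  cases L <;> exact Iff.rfl

/-- `I` is itself the least member of its up-set, and so the witness for every absent atom. -/
theorem Literal.knownIn_setOf_superset {I : Interp S} {L : Literal S} :
    L.KnownIn {J | I ⊆ J} ↔ L.HoldsIn I := by
  cases L with
  | pos p => exact ⟨fun h => h I (Set.Subset.refl I), fun h J hJ => hJ h⟩
  | neg p => exact ⟨fun ⟨J, hJ, hp⟩ hI => hp (hJ hI), fun h => ⟨I, Set.Subset.refl I, h⟩⟩

theorem sat_conj {M N : Set (Interp S)} {n : ℕ} {l : List (Formula S n)} {I : Interp S}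
    {e : Fin n → S.Const} : Sat M N (Formula.conj l) I e ↔ ∀ φ ∈ l, Sat M N φ I e := by
  induction l with
  | nil => simp [Formula.conj, Sat]
  | cons φ l ih =>
    rw [List.forall_mem_cons, ← ih]
    rfl

theorem sat_rule_toMKNF {X : Set (Interp S)} {r : Rule S} {I : Interp S}
    {e : Fin 0 → S.Const} :
    Sat X X r.toMKNF I e ↔ ((∀ L ∈ r.body, L.KnownIn X) → r.head.KnownIn X) := by
  simp only [Rule.toMKNF, Formula.imp, Sat, sat_conj, List.mem_map, Finset.mem_toList,
    forall_exists_index, and_imp, forall_apply_eq_imp_iff₂, sat_literal_toMKNF]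
  tauto

theorem Literal.knownIn_congr {V : Set S.Pred} {X Y : Set (Interp S)}
    (hXY : ∀ J ∈ X, ∃ J' ∈ Y, AgreeOn V J J') (hYX : Y ⊆ X) {L : Literal S}
    (hL : L.preds ⊆ V) : L.KnownIn X ↔ L.KnownIn Y := by
  cases L with
  | pos p =>
    refine ⟨fun h J hJ => h J (hYX hJ), fun h J hJ => ?_⟩
    obtain ⟨J', hJ', ha⟩ := hXY J hJ
    exact (ha p (hL rfl)).2 (h J' hJ')
  | neg p =>
    refine ⟨fun ⟨J, hJ, hp⟩ => ?_, fun ⟨J, hJ, hp⟩ => ⟨J, hYX hJ, hp⟩⟩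
    obtain ⟨J', hJ', ha⟩ := hXY J hJ
    exact ⟨J', hJ', fun h => hp ((ha p (hL rfl)).2 h)⟩

theorem Literal.exists_preds_eq (L : Literal S) : ∃ P, L.preds = {P} := by
  cases L <;> exact ⟨_, rfl⟩

/-! ### Basic dynamic hybrid knowledge bases -/

variable {D : DescriptionLogic.{u, v, w} S}

theorem HybridKB.isFirstOrder_of_mem_foTheory {K : HybridKB D} {φ : Sentence S}
    (h : φ ∈ K.foTheory) : φ.IsFirstOrder := by
  rcases h with ⟨a, -, rfl⟩ | ⟨_, -, _, -, -, rfl⟩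
  · exact (D.toFO a).2
  · trivial

/-- All ontology axioms and rule heads of `K` use predicate symbols from `V` only. -/
def HybridKB.IsOver (V : Set S.Pred) (K : HybridKB D) : Prop :=
  (∀ a ∈ K.ont, D.preds a ⊆ V) ∧ ∀ r ∈ K.prog, r.head.preds ⊆ V

theorem HybridKB.IsOver.preds_subset_of_mem_foTheory {V : Set S.Pred} {K : HybridKB D}
    (hK : K.IsOver V) {φ : Sentence S} (h : φ ∈ K.foTheory) : φ.preds ⊆ V := by
  rcases h with ⟨a, ha, rfl⟩ | ⟨r, hr, p, hp, -, rfl⟩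
  · exact hK.1 a ha
  · have := hK.2 r hr
    rw [hp] at this
    exact this

namespace DynamicKB

/-- In the rule case only heads matter: every atom of a stable model is the head of some rule, so
the up-set of `I` constrains head predicates alone. -/
theorem IsBasicDynamicModel.dependsOn {n : ℕ} {K : DynamicKB D n} {X : Set (Interp S)}
    (h : IsBasicDynamicModel K X) {V : Set S.Pred} (hK : ∀ i, (K i).IsOver V) :
    DependsOn V X := by
  obtain ⟨-, ⟨-, -, rfl⟩ | ⟨-, I, hI, rfl⟩⟩ := h
  · exact dependsOn_updateSeq _ _ fun i => dependsOn_modelSet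
      (fun _ => HybridKB.isFirstOrder_of_mem_foTheory)
      fun _ => (hK i).preds_subset_of_mem_foTheory
  · intro J J' hJ hIJ p hp
    obtain ⟨i, r, hr, hrp⟩ := hI.exists_rule_of_mem hp
    refine (hJ p ((hK i).2 r hr ?_)).1 (hIJ hp)
    rw [hrp]
    rfl

theorem IsBasicDynamicModel.sat_toFO {n : ℕ} {K : DynamicKB D (n + 1)} {X : Set (Interp S)}
    (h : IsBasicDynamicModel K X) {a : D.Axiom} (ha : a ∈ (K (Fin.last n)).ont)
    (M N : Set (Interp S)) {J : Interp S} (hJ : J ∈ X) : Sat M N (D.toFO a).1 J ![] := by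
  obtain ⟨-, ⟨-, -, rfl⟩ | ⟨hP, -⟩⟩ := h
  · exact (mem_modelSet_iff (fun _ => HybridKB.isFirstOrder_of_mem_foTheory) M N).1
      (updateSeq_subset_last _ _ hJ) _ (.inl ⟨a, ha, rfl⟩)
  · have hP' : (K (Fin.last n)).ont = ∅ := hP _
    rw [hP'] at ha
    exact ha.elim

theorem IsBasicDynamicModel.head_knownIn {n : ℕ} {K : DynamicKB D (n + 1)}
    {X : Set (Interp S)} (h : IsBasicDynamicModel K X) {r : Rule S}
    (hr : r ∈ (K (Fin.last n)).prog) (hB : ∀ L ∈ r.body, L.KnownIn X) :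
    r.head.KnownIn X := by
  obtain ⟨-, ⟨hO, -, rfl⟩ | ⟨-, I, hI, rfl⟩⟩ := h
  · obtain ⟨⟨p, hp⟩, hf⟩ := hO _ r hr
    rw [hp]
    intro J hJ
    exact (mem_modelSet_iff (fun _ => HybridKB.isFirstOrder_of_mem_foTheory) ∅ ∅).1
      (updateSeq_subset_last _ _ hJ) p.toSentence (.inr ⟨r, hr, p, hp, hf, rfl⟩)
  · rw [Literal.knownIn_setOf_superset]
    exact hI.head_holds hr fun L hL => Literal.knownIn_setOf_superset.1 (hB L hL)

end DynamicKB

/-! ### Layers of a splitting sequence -/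

/-- The predicate symbols that enter the sequence `U` at stage `α`. -/
def layer (U : Ordinal.{x} → Set S.Pred) (α : Ordinal.{x}) : Set S.Pred :=
  {P ∈ U α | ∀ η < α, P ∉ U η}

theorem disjoint_layer {U : Ordinal.{x} → Set S.Pred} {α β : Ordinal.{x}} (h : α ≠ β) :
    Disjoint (layer U α) (layer U β) := by
  rw [Set.disjoint_left]
  rintro P ⟨hα, hα'⟩ ⟨hβ, hβ'⟩
  rcases h.lt_or_gt with hlt | hlt
  · exact hβ' _ hlt hα
  · exact hα' _ hlt hβ

theorem exists_mem_layer_le {U : Ordinal.{x} → Set S.Pred} {α : Ordinal.{x}} {P : S.Pred}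
    (h : P ∈ U α) : ∃ β ≤ α, P ∈ layer U β := by
  induction α using WellFoundedLT.induction with
  | ind α ih =>
    by_cases hη : ∃ η < α, P ∈ U η
    · obtain ⟨η, hlt, hP⟩ := hη
      obtain ⟨β, hβ, hPβ⟩ := ih η hlt hP
      exact ⟨β, hβ.trans hlt.le, hPβ⟩
    · exact ⟨α, le_rfl, h, fun η hlt hP => hη ⟨η, hlt, hP⟩⟩

theorem layer_zero (U : Ordinal.{x} → Set S.Pred) : layer U 0 = U 0 := by
  simp [layer]

namespace HybridKB.IsSplittingSequence

variable {K : HybridKB D} {μ : Ordinal.{x}} {U : Ordinal.{x} → Set S.Pred}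

theorem layer_succ (h : K.IsSplittingSequence μ U) {α : Ordinal.{x}} (hα : α + 1 < μ) :
    layer U (α + 1) = U (α + 1) \ U α := by
  ext P
  refine and_congr_right fun _ => ⟨fun hP => hP α (Order.lt_add_one_iff.2 le_rfl), ?_⟩
  intro hP η hη hPη
  exact hP (h.mono η α (Order.lt_add_one_iff.1 hη)
    ((Order.lt_add_one_iff.2 le_rfl).trans hα) hPη)

theorem layer_limit (h : K.IsSplittingSequence μ U) {α : Ordinal.{x}} (hα : α < μ)
    (hlim : Order.IsSuccLimit α) : layer U α = ∅ := by
  rw [Set.eq_empty_iff_forall_notMem]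
  rintro P ⟨hP, hP'⟩
  rw [h.continuous α hα hlim] at hP
  simp only [Set.mem_iUnion, exists_prop] at hP
  obtain ⟨η, hη, hPη⟩ := hP
  exact hP' η hη hPη

theorem exists_mem_layer (h : K.IsSplittingSequence μ U) (P : S.Pred) :
    ∃ α < μ, P ∈ layer U α := by
  have hP : P ∈ ⋃ α < μ, U α := by rw [h.exhausts]; trivial
  simp only [Set.mem_iUnion, exists_prop] at hP
  obtain ⟨α, hα, hPα⟩ := hP
  obtain ⟨β, hβ, hPβ⟩ := exists_mem_layer_le hPα
  exact ⟨β, hβ.trans_lt hα, hPβ⟩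

/-- Nonempty layers occur at stage zero and at successor stages only. -/
theorem eq_zero_or_succ_of_mem_layer (h : K.IsSplittingSequence μ U) {α : Ordinal.{x}}
    (hα : α < μ) {P : S.Pred} (hP : P ∈ layer U α) : α = 0 ∨ ∃ γ, α = γ + 1 := by
  rcases Ordinal.zero_or_succ_or_isSuccLimit α with h0 | ⟨γ, hγ⟩ | hlim
  · exact .inl h0
  · exact .inr ⟨γ, hγ.symm⟩
  · rw [h.layer_limit hα hlim] at hP
    exact hP.elim

theorem isOver_bottom_zero (U : Ordinal.{x} → Set S.Pred) (K : HybridKB D) :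
    (K.bottom (U 0)).IsOver (layer U 0) := by
  rw [layer_zero]
  exact ⟨fun a ha => ha.2, fun r hr => Set.subset_union_left.trans hr.2⟩

/-- An axiom or rule head that touches `U α` lies, by the splitting property, with all its symbols
in `U α`; it then belongs to the bottom and is absent from the top. -/
theorem isOver_reduct (h : K.IsSplittingSequence μ U) {α : Ordinal.{x}} (hα : α + 1 < μ)
    (Y : Set (Interp S)) :
    ((K.bottom (U (α + 1))).reduct (U α) Y).IsOver (layer U (α + 1)) := by
  have hs := h.splitting α ((Order.lt_add_one_iff.2 le_rfl).trans hα)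
  rw [h.layer_succ hα]
  refine ⟨fun a ha P hP => ⟨ha.1.2 hP, fun hPU => ?_⟩, ?_⟩
  · exact ha.2 ⟨ha.1, hs.1 a ha.1.1 ⟨P, hP, hPU⟩⟩
  · rintro r' ⟨r, hr, -, hhead, -⟩ P hP
    rw [hhead] at hP
    exact ⟨hr.1.2 (.inl hP), fun hPU => hr.2 ⟨hr.1, hs.2 r hr.1.1 ⟨P, hP, hPU⟩⟩⟩

end HybridKB.IsSplittingSequence

/-! ### Solutions -/

namespace DynamicKB

theorem IsSolution.dependsOn {n : ℕ} {K : DynamicKB D n} {μ : Ordinal.{x}}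
    {U : Ordinal.{x} → Set S.Pred} {X : Ordinal.{x} → Set (Interp S)}
    (hX : IsSolution μ U K X) (hU : IsSplittingSequence μ U K) {α : Ordinal.{x}} (hα : α < μ) :
    DependsOn (layer U α) (X α) := by
  rcases Ordinal.zero_or_succ_or_isSuccLimit α with rfl | ⟨γ, rfl⟩ | hlim
  · exact hX.zero.dependsOn fun i =>
      HybridKB.IsSplittingSequence.isOver_bottom_zero U (K i)
  · exact (hX.succ γ hα).dependsOn fun i => (hU i).isOver_reduct hα _
  · rw [hX.limit α hα hlim]
    exact fun _ _ _ _ => trivial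

/-- A literal over the layer of stage `α` is known in `X α` iff it is known in any set between
the intersection of all stages and `X α`. -/
theorem IsSolution.knownIn_iff {n : ℕ} {K : DynamicKB D n} {μ : Ordinal.{x}}
    {U : Ordinal.{x} → Set S.Pred} {X : Ordinal.{x} → Set (Interp S)}
    (hX : IsSolution μ U K X) (hU : IsSplittingSequence μ U K)
    (hne : (⋂ α < μ, X α).Nonempty) {α : Ordinal.{x}} (hα : α < μ) {Y : Set (Interp S)}
    (hY : (⋂ α < μ, X α) ⊆ Y) (hYX : Y ⊆ X α) {L : Literal S} (hL : L.preds ⊆ layer U α) :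
    L.KnownIn (X α) ↔ L.KnownIn Y := by
  refine Literal.knownIn_congr (V := layer U α) (fun J hJ => ?_) hYX hL
  obtain ⟨J₀, hJ₀⟩ := hne
  -- The glued interpretation lies in `X α` because of `J`, and in every other stage because of
  -- `J₀`, the layers being disjoint.
  refine ⟨merge (layer U α) J J₀, hY ?_, agreeOn_merge _ _ _⟩
  simp only [Set.mem_iInter] at hJ₀ ⊢
  intro β hβ
  by_cases h : α = β
  · subst h
    exact hX.dependsOn hU hα (agreeOn_merge _ _ _) hJ
  · exact hX.dependsOn hU hβ (agreeOn_merge_of_disjoint (disjoint_layer h) _ _) (hJ₀ β hβ)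

variable {n : ℕ} {K : DynamicKB D (n + 1)} {μ : Ordinal.{x}} {U : Ordinal.{x} → Set S.Pred}
  {X : Ordinal.{x} → Set (Interp S)}

theorem IsSolution.sat_toFO (hX : IsSolution μ U K X) (hU : IsSplittingSequence μ U K)
    {a : D.Axiom} (ha : a ∈ (K (Fin.last n)).ont) (M N : Set (Interp S)) {J : Interp S}
    (hJ : J ∈ ⋂ α < μ, X α) : Sat M N (D.toFO a).1 J ![] := by
  have hs := hU (Fin.last n)
  simp only [Set.mem_iInter] at hJ
  -- An axiom without predicate symbols has no layer; this case split sends it to stage zero.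
  by_cases h0 : D.preds a ⊆ U 0
  · exact hX.zero.sat_toFO (K := bottom (U 0) K) ⟨ha, h0⟩ M N (hJ 0 hs.pos)
  obtain ⟨P, hP, hP0⟩ := Set.not_subset.1 h0
  obtain ⟨α, hα, hPα⟩ := hs.exists_mem_layer P
  rcases hs.eq_zero_or_succ_of_mem_layer hα hPα with rfl | ⟨γ, rfl⟩
  · exact (hP0 hPα.1).elim
  rw [hs.layer_succ hα] at hPα
  refine (hX.succ γ hα).sat_toFO (a := a) ?_ M N (hJ _ hα)
  exact ⟨⟨ha, (hs.splitting _ hα).1 a ha ⟨P, hP, hPα.1⟩⟩, fun h => hPα.2 (h.2 hP)⟩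

theorem IsSolution.head_knownIn (hX : IsSolution μ U K X) (hU : IsSplittingSequence μ U K)
    (hne : (⋂ α < μ, X α).Nonempty) {r : Rule S} (hr : r ∈ (K (Fin.last n)).prog)
    (hB : ∀ L ∈ r.body, L.KnownIn (⋂ α < μ, X α)) : r.head.KnownIn (⋂ α < μ, X α) := by
  classical
  have hs := hU (Fin.last n)
  have hsub : ∀ {α}, α < μ → (⋂ β < μ, X β) ⊆ X α := fun hα => Set.biInter_subset_of_mem hα
  have hbody : ∀ L ∈ r.body, L.preds ⊆ r.preds := fun L hL =>
    (Set.subset_biUnion_of_mem (u := fun L : Literal S => L.preds) hL).trans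
      Set.subset_union_right
  obtain ⟨P, hP⟩ := r.head.exists_preds_eq
  obtain ⟨α, hα, hPα⟩ := hs.exists_mem_layer P
  have hhead : r.head.preds ⊆ layer U α := by rw [hP]; exact Set.singleton_subset_iff.2 hPα
  have hpreds : r.preds ⊆ U α :=
    (hs.splitting α hα).2 r hr ⟨P, by rw [hP]; rfl, hPα.1⟩
  rw [← hX.knownIn_iff hU hne hα subset_rfl (hsub hα) hhead]
  rcases hs.eq_zero_or_succ_of_mem_layer hα hPα with rfl | ⟨γ, rfl⟩
  · refine hX.zero.head_knownIn (K := bottom (U 0) K) ⟨hr, hpreds⟩ fun L hL => ?_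
    rw [hX.knownIn_iff hU hne hα subset_rfl (hsub hα)
      (by rw [layer_zero]; exact (hbody L hL).trans hpreds)]
    exact hB L hL
  rw [hs.layer_succ hα] at hPα
  have hγ : γ < μ := (Order.lt_add_one_iff.2 le_rfl).trans hα
  -- The form `r` takes in the reduct at stage `γ + 1`: body literals over `U γ` are evaluated and
  -- removed.
  let r' : Rule S := ⟨r.head, {L ∈ r.body | L.preds ⊆ (U γ)ᶜ}⟩
  refine (hX.succ γ hα).head_knownIn (r := r') ?_ fun L hL => ?_
  · refine ⟨r, ⟨⟨hr, hpreds⟩, fun h => hPα.2 (h.2 (.inl (by rw [hP]; rfl)))⟩, ?_, rfl,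
      fun L => Finset.mem_filter⟩
    rintro _ ⟨L, hL, hLU, rfl⟩ I -
    rw [sat_literal_toMKNF]
    obtain ⟨Q, hQ⟩ := L.exists_preds_eq
    obtain ⟨β, hβ, hQβ⟩ := exists_mem_layer_le (hLU (hQ ▸ rfl : Q ∈ L.preds))
    have hLβ : L.preds ⊆ layer U β := by rw [hQ]; exact Set.singleton_subset_iff.2 hQβ
    have hβμ : β < μ := hβ.trans_lt hγ
    -- The reduct evaluates `L` in the intersection up to `γ`, the hypothesis in the full one. Since
    -- `β ≤ γ`, both agree with `X β` on `L`.
    rw [← hX.knownIn_iff hU hne (Y := ⋂ η ≤ γ, X η) hβμ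
        (Set.biInter_mono (fun η hη => lt_of_le_of_lt hη hγ) fun _ _ => subset_rfl)
        (Set.biInter_subset_of_mem hβ) hLβ,
      hX.knownIn_iff hU hne hβμ subset_rfl (hsub hβμ) hLβ]
    exact hB L hL
  · obtain ⟨hL, hLU⟩ := Finset.mem_filter.1 hL
    rw [hX.knownIn_iff hU hne hα subset_rfl (hsub hα)]
    · exact hB L hL
    · rw [hs.layer_succ hα]
      exact fun Q hQ => ⟨hpreds (hbody L hL hQ), hLU hQ⟩

end DynamicKB

end HybridMKNF

theorem mainTheorem7 {S : HybridMKNF.Signature} {D : HybridMKNF.DescriptionLogic S}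
    {n : ℕ} (hn : 0 < n) (K : HybridMKNF.DynamicKB D n)
    (hK : HybridMKNF.DynamicKB.IsUpdatable K)
    (M : Set (HybridMKNF.Interp S)) (hM : HybridMKNF.DynamicKB.IsDynamicModel K M) :
    HybridMKNF.Models M (K ⟨n - 1, Nat.sub_lt hn Nat.one_pos⟩).toMKNF := by
  -- With the length written as a successor, the index in the statement is definitionally `Fin.last
  -- n`.
  obtain ⟨n, rfl⟩ := Nat.exists_eq_add_one.2 hn
  obtain ⟨μ, U, hU, hne, X, hX, rfl⟩ := hM
  rintro φ (⟨a, ha, rfl⟩ | ⟨r, hr, rfl⟩) I hI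
  · exact fun J hJ => hX.sat_toFO hU.splitting ha _ _ hJ
  · exact HybridMKNF.sat_rule_toMKNF.2 fun hB => hX.head_knownIn hU.splitting hne hr hB
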